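/- Let $q>1$ be a real number. For $z\in\mathbb{C}^{\star}=\mathbb{C}\setminus\{0\}$ let $$\Theta_q(z)=\sum_{n\in\mathbb{Z}}\frac{z^n}{q^{n(n-1)/2}},$$ and for $z\in\mathbb{C}$ let $$E_q(z)=\sum_{n\ge 0}\frac{z^n}{q^{n(n-1)/2}}.$$ Call $\alpha\in\mathbb{R}$ an admissible growth exponent of $E_q$ if there is $K>0$ such that $$|E_q(z)|\le K\exp\left(\frac{\log^2|z|}{2\log q}\right)|z|^{\alpha}\qquad\text{for all } z\in\mathbb{C}^{\star}.$$ Admissible growth exponents exist. Let $\alpha$ be any admissible growth exponent of $E_q$, let $\omega,z\in\mathbb{C}^{\star}$ with $\omega\neq z$, and let $d\in\mathbb{R}$ be such that $\arg(\omega/z)+d\neq\pm\pi$ modulo $2\pi$ (that is, $\arg(\omega/z)+d$ is not an odd multiple of $\pi$) and $$\left|\frac{\omega}{z}\right|>q^{\alpha-\frac12}.$$ Then, with $L_d=[0,\infty)e^{id}$, the following integral converges absolutely and $$\frac{z}{\omega-z}=\frac{q}{\log q}\int_{L_d}\frac{E_q(\xi)}{\Theta_q\left(q\frac{\omega\xi}{z}\right)}\,d\xi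 .$$ -/

import Mathlib

noncomputable section

/-- The Jacobi Theta function `Θ_q(z) = ∑_{n ∈ ℤ} z ^ n / q ^ (n(n-1)/2)`, for `q > 1`, `z ≠ 0`.
The integer `n(n-1)` is even, so the division in the exponent is exact. -/
def qTheta (q : ℝ) (z : ℂ) : ℂ :=
  ∑' n : ℤ, 1 / (q : ℂ) ^ (n * (n - 1) / 2) * z ^ n

/-- The entire function `E_q(z) = ∑_{n ≥ 0} z ^ n / q ^ (n(n-1)/2)`, for `q > 1`. -/
def qE (q : ℝ) (z : ℂ) : ℂ :=
  ∑' n : ℕ, 1 / (q : ℂ) ^ (n * (n - 1) / 2) * z ^ n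

/-- `α` is an admissible exponent for the growth of `E_q`: for some `K > 0`,
`|E_q(z)| ≤ K exp (log² |z| / (2 log q)) |z| ^ α` for all `z ≠ 0`.
(As `z → 0` the right-hand side tends to `+∞`, so the point `0` carries no condition.) -/
def IsGrowthExponent (q α : ℝ) : Prop :=
  ∃ K : ℝ, 0 < K ∧ ∀ z : ℂ, z ≠ 0 →
    ‖qE q z‖ ≤ K * Real.exp (Real.log ‖z‖ ^ 2 / (2 * Real.log q)) * ‖z‖ ^ α

/-- Absolute convergence of `∫_{L_d} f(ξ) dξ` along the ray `L_d = [0, ∞) e^{id}`,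
parametrized by `ξ = r e^{id}`. -/
def RayIntegrable (d : ℝ) (f : ℂ → ℂ) : Prop :=
  MeasureTheory.IntegrableOn
    (fun r : ℝ => f (r * Complex.exp (d * Complex.I)) * Complex.exp (d * Complex.I))
    (Set.Ioi 0)

/-- The integral `∫_{L_d} f(ξ) dξ` along the ray `L_d = [0, ∞) e^{id}`,
parametrized by `ξ = r e^{id}`. -/
def rayIntegral (d : ℝ) (f : ℂ → ℂ) : ℂ :=
  ∫ r in Set.Ioi (0 : ℝ),
    f (r * Complex.exp (d * Complex.I)) * Complex.exp (d * Complex.I)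

end

/-! Put `λ = ω / z` and `w = qλξ`. On the ray, `w = s q ^ t` with `s = qλ e^{id}` and `t ∈ ℝ`, and
`dξ = log q · ξ dt`. The claim becomes `∫ E_q(w / (qλ)) · w / Θ_q(w) dt = λ / (λ - 1)`.

Let `c_n = q ^ (-n(n-1)/2)`. The key fact is that `c_n ∫ w ^ n / Θ_q(w) dt = 1` for every `n ≥ 0`.
For `n = 0`, cut `ℝ` into unit intervals: by `Θ_q(qw) = q w Θ_q(w)`, the integer translates of `1 /
Θ_q` sum to `Θ_q / Θ_q = 1`. For larger `n`, a unit shift of `t` lowers `n` by one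
(`thetaKernel_succ`). Expanding `E_q` termwise then gives `∑ λ ^ (-n)`, and the same shift applied
to norms justifies the interchange when `|λ| > 1`.

Two inputs remain: `Θ_q` has no zero off the negative axis (Jacobi triple product,
`qTheta_ne_zero`), and admissible exponents satisfy `α ≥ 1/2` (`IsGrowthExponent.half_le`), so the
hypothesis on `|ω / z|` forces `|λ| > 1`. -/

open Filter Topology MeasureTheory

/-! ### The Theta series: convergence, functional equation, continuity. -/

/-- The coefficients `q ^ (-n(n-1)/2)` of the Theta series. -/
noncomputable def thetaCoeff (q : ℝ) (n : ℤ) : ℝ := 1 / q ^ (n * (n - 1) / 2)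

theorem thetaCoeff_pos {q : ℝ} (hq : 0 < q) (n : ℤ) : 0 < thetaCoeff q n := by
  unfold thetaCoeff; positivity

theorem thetaCoeff_zero (q : ℝ) : thetaCoeff q 0 = 1 := by simp [thetaCoeff]

theorem thetaCoeff_succ {q : ℝ} (hq : 0 < q) (n : ℤ) :
    thetaCoeff q (n + 1) = thetaCoeff q n * (q ^ n)⁻¹ := by
  have h : (n + 1) * (n + 1 - 1) / 2 = n * (n - 1) / 2 + n := by
    rw [← Int.add_mul_ediv_right _ _ (by norm_num : (2 : ℤ) ≠ 0)]
    congr 1; ring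
  unfold thetaCoeff
  rw [h, zpow_add₀ hq.ne']
  field_simp

theorem thetaCoeff_neg {q : ℝ} (hq : 0 < q) (n : ℤ) :
    thetaCoeff q (-n) = thetaCoeff q n * (q ^ n)⁻¹ := by
  rw [← thetaCoeff_succ hq]
  unfold thetaCoeff
  congr 3; ring

theorem ofReal_thetaCoeff (q : ℝ) (n : ℤ) :
    ((thetaCoeff q n : ℝ) : ℂ) = 1 / (q : ℂ) ^ (n * (n - 1) / 2) := by
  simp [thetaCoeff]

theorem ofReal_thetaCoeff_natCast (q : ℝ) (n : ℕ) :
    ((thetaCoeff q n : ℝ) : ℂ) = 1 / (q : ℂ) ^ (n * (n - 1) / 2) := by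
  rw [ofReal_thetaCoeff, ← zpow_natCast]
  congr 2
  -- At `n = 0` the truncated `n - 1` is harmless, being multiplied by `n`.
  cases n <;> simp

theorem qTheta_eq (q : ℝ) (z : ℂ) : qTheta q z = ∑' n : ℤ, (thetaCoeff q n : ℂ) * z ^ n := by
  simp only [qTheta, ofReal_thetaCoeff]

theorem qE_eq (q : ℝ) (z : ℂ) : qE q z = ∑' n : ℕ, (thetaCoeff q n : ℂ) * z ^ n := by
  simp only [qE, ofReal_thetaCoeff_natCast]

theorem summable_thetaCoeff_nat {q : ℝ} (hq : 1 < q) {R : ℝ} (hR : 0 < R) :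
    Summable fun n : ℕ => thetaCoeff q n * R ^ n := by
  have hq0 : 0 < q := by linarith
  have hpos : ∀ n : ℕ, 0 < thetaCoeff q n * R ^ n := fun n =>
    mul_pos (thetaCoeff_pos hq0 _) (pow_pos hR _)
  refine summable_of_ratio_test_tendsto_lt_one zero_lt_one
    (Eventually.of_forall fun n => (hpos n).ne') ?_
  have h : ∀ n : ℕ, ‖thetaCoeff q ((n + 1 : ℕ) : ℤ) * R ^ (n + 1)‖ / ‖thetaCoeff q n * R ^ n‖
      = (q⁻¹) ^ n * R := by
    intro n
    rw [Real.norm_of_nonneg (hpos _).le, Real.norm_of_nonneg (hpos _).le, Nat.cast_succ,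
      thetaCoeff_succ hq0, pow_succ, zpow_natCast, inv_pow]
    have := (thetaCoeff_pos hq0 n).ne'
    field_simp
  simp only [h]
  simpa using (tendsto_pow_atTop_nhds_zero_of_lt_one (by positivity) (inv_lt_one_of_one_lt₀ hq)).mul_const R

theorem summable_thetaCoeff {q : ℝ} (hq : 1 < q) {R : ℝ} (hR : 0 < R) :
    Summable fun n : ℤ => thetaCoeff q n * R ^ n := by
  have hq0 : 0 < q := by linarith
  refine Summable.of_nat_of_neg (by simpa using summable_thetaCoeff_nat hq hR) ?_
  refine (summable_thetaCoeff_nat hq (R := (q * R)⁻¹) (by positivity)).congr fun n => ?_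
  rw [thetaCoeff_neg hq0, zpow_neg, zpow_natCast, zpow_natCast, inv_pow, mul_pow, mul_inv, mul_assoc]

theorem norm_thetaCoeff_mul {q : ℝ} (hq : 0 < q) (n : ℤ) (z : ℂ) :
    ‖(thetaCoeff q n : ℂ) * z ^ n‖ = thetaCoeff q n * ‖z‖ ^ n := by
  rw [norm_mul, norm_zpow, Complex.norm_real, Real.norm_of_nonneg (thetaCoeff_pos hq n).le]

theorem summable_qTheta {q : ℝ} (hq : 1 < q) {z : ℂ} (hz : z ≠ 0) :
    Summable fun n : ℤ => (thetaCoeff q n : ℂ) * z ^ n := by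
  refine Summable.of_norm ((summable_thetaCoeff hq (norm_pos_iff.2 hz)).congr fun n => ?_)
  rw [norm_thetaCoeff_mul (by linarith)]

theorem hasSum_qTheta {q : ℝ} (hq : 1 < q) {z : ℂ} (hz : z ≠ 0) :
    HasSum (fun n : ℤ => (thetaCoeff q n : ℂ) * z ^ n) (qTheta q z) := by
  rw [qTheta_eq]; exact (summable_qTheta hq hz).hasSum

theorem qTheta_q_mul {q : ℝ} (hq : 1 < q) {z : ℂ} (hz : z ≠ 0) :
    qTheta q (q * z) = q * z * qTheta q z := by
  have hq0 : 0 < q := by linarith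
  have hqc : (q : ℂ) ≠ 0 := by exact_mod_cast hq0.ne'
  rw [qTheta_eq, ← (Equiv.addRight (1 : ℤ)).tsum_eq, qTheta_eq, ← tsum_mul_left]
  refine tsum_congr fun n => ?_
  simp only [Equiv.coe_addRight]
  rw [thetaCoeff_succ hq0, zpow_add_one₀ (mul_ne_zero hqc hz), mul_zpow]
  push_cast
  field_simp

theorem qTheta_eq_zpow_mul {q : ℝ} (hq : 1 < q) {z : ℂ} (hz : z ≠ 0) (k : ℤ) :
    (thetaCoeff q (-k) : ℂ) * z ^ (-k) * qTheta q ((q : ℂ) ^ k * z) = qTheta q z := by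
  have hq0 : 0 < q := by linarith
  have hqc : (q : ℂ) ≠ 0 := by exact_mod_cast hq0.ne'
  -- The left-hand side does not depend on `k`; at `k = 0` it is `Θ_q(z)`.
  have step : ∀ k : ℤ, (thetaCoeff q (-(k + 1)) : ℂ) * z ^ (-(k + 1)) *
      qTheta q ((q : ℂ) ^ (k + 1) * z)
      = (thetaCoeff q (-k) : ℂ) * z ^ (-k) * qTheta q ((q : ℂ) ^ k * z) := by
    intro k
    have e : -k = -(k + 1) + 1 := by ring
    have h1 : thetaCoeff q (-k) = thetaCoeff q (-(k + 1)) * q ^ (k + 1) := by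
      rw [e, thetaCoeff_succ hq0, zpow_neg, inv_inv]
    have h2 : z ^ (-k) = z ^ (-(k + 1)) * z := by rw [e, zpow_add_one₀ hz]
    have h3 : (q : ℂ) ^ (k + 1) * z = q * ((q : ℂ) ^ k * z) := by rw [zpow_add_one₀ hqc]; ring
    rw [h3, qTheta_q_mul hq (mul_ne_zero (zpow_ne_zero _ hqc) hz), h1, h2]
    push_cast
    rw [zpow_add_one₀ hqc]
    ring
  induction k using Int.induction_on with
  | zero => simp [thetaCoeff_zero]
  | succ n ih => rw [step, ih]
  | pred n ih => rw [← step, sub_add_cancel, ih]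

theorem zpow_le_zpow_add_zpow {a b x : ℝ} (ha : 0 < a) (hax : a ≤ x) (hxb : x ≤ b) (n : ℤ) :
    x ^ n ≤ a ^ n + b ^ n := by
  have hx : 0 < x := ha.trans_le hax
  have hb : 0 < b := hx.trans_le hxb
  rcases le_total 0 n with hn | hn
  · have := zpow_le_zpow_left₀ hn hx.le hxb
    have := zpow_pos ha n
    linarith
  · obtain ⟨m, rfl⟩ : ∃ m, n = -m := ⟨-n, by ring⟩
    have h := zpow_le_zpow_left₀ (by linarith : 0 ≤ m) ha.le hax
    have := zpow_pos hb (-m)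
    have h2 : x ^ (-m) ≤ a ^ (-m) := by
      rw [zpow_neg, zpow_neg]; exact inv_anti₀ (zpow_pos ha m) h
    linarith

theorem summable_thetaCoeff_add {q : ℝ} (hq : 1 < q) {a b : ℝ} (ha : 0 < a) (hb : 0 < b) :
    Summable fun n : ℤ => thetaCoeff q n * (a ^ n + b ^ n) :=
  ((summable_thetaCoeff hq ha).add (summable_thetaCoeff hq hb)).congr fun n => by ring

theorem continuousAt_qTheta {q : ℝ} (hq : 1 < q) {z : ℂ} (hz : z ≠ 0) :
    ContinuousAt (qTheta q) z := by
  have hq0 : 0 < q := by linarith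
  have hn : 0 < ‖z‖ := norm_pos_iff.2 hz
  have hs : ContinuousOn (fun w => ∑' n : ℤ, (thetaCoeff q n : ℂ) * w ^ n)
      {w | ‖z‖ / 2 ≤ ‖w‖ ∧ ‖w‖ ≤ 2 * ‖z‖} := by
    refine continuousOn_tsum (u := fun n : ℤ => thetaCoeff q n * ((‖z‖ / 2) ^ n + (2 * ‖z‖) ^ n))
      (fun n w hw => ?_) (summable_thetaCoeff_add hq (by positivity) (by positivity))
      fun n w hw => ?_
    · have : w ≠ 0 := norm_pos_iff.1 (by have := hw.1; linarith)
      exact (continuousAt_const.mul (continuousAt_zpow₀ _ _ (Or.inl this))).continuousWithinAt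
    · rw [norm_thetaCoeff_mul hq0]
      exact mul_le_mul_of_nonneg_left (zpow_le_zpow_add_zpow (by positivity) hw.1 hw.2 n)
        (thetaCoeff_pos hq0 n).le
  have he : qTheta q = fun w => ∑' n : ℤ, (thetaCoeff q n : ℂ) * w ^ n := funext (qTheta_eq q)
  rw [he]
  refine hs.continuousAt ?_
  have h1 : ∀ᶠ w in 𝓝 z, ‖z‖ / 2 < ‖w‖ :=
    continuous_norm.continuousAt.eventually (lt_mem_nhds (by linarith))
  have h2 : ∀ᶠ w in 𝓝 z, ‖w‖ < 2 * ‖z‖ :=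
    continuous_norm.continuousAt.eventually (gt_mem_nhds (by linarith))
  filter_upwards [h1, h2] with w a b using ⟨a.le, b.le⟩

/-! ### Jacobi triple product and the zeros of `Θ_q`. -/

/-- The finite `q`-Pochhammer symbol `(p; p)_n = ∏_{k=1}^n (1 - p ^ k)`. -/
noncomputable def eulerProd (p : ℝ) (n : ℕ) : ℝ := ∏ k ∈ Finset.range n, (1 - p ^ (k + 1))

theorem eulerProd_succ (p : ℝ) (n : ℕ) :
    eulerProd p (n + 1) = eulerProd p n * (1 - p ^ (n + 1)) := Finset.prod_range_succ _ _

theorem eulerProd_pos {p : ℝ} (h0 : 0 < p) (h1 : p < 1) (n : ℕ) : 0 < eulerProd p n :=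
  Finset.prod_pos fun k _ => sub_pos.2 (pow_lt_one₀ h0.le h1 (by omega))

theorem eulerProd_antitone {p : ℝ} (h0 : 0 < p) (h1 : p < 1) : Antitone (eulerProd p) := by
  refine antitone_nat_of_succ_le fun n => ?_
  rw [eulerProd_succ]
  have := eulerProd_pos h0 h1 n
  have : 0 < p ^ (n + 1) := by positivity
  nlinarith

theorem exists_tendsto_eulerProd {p : ℝ} (h0 : 0 < p) (h1 : p < 1) :
    ∃ L, 0 < L ∧ Tendsto (eulerProd p) atTop (𝓝 L) ∧ ∀ n, L ≤ eulerProd p n := by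
  have hs : Summable fun k : ℕ => ‖-(p ^ (k + 1))‖ := by
    simp only [norm_neg, norm_pow, Real.norm_of_nonneg h0.le]
    exact (summable_nat_add_iff 1).2 (summable_geometric_of_lt_one h0.le h1)
  have ht : Tendsto (eulerProd p) atTop (𝓝 (∏' k : ℕ, (1 + -(p ^ (k + 1))))) := by
    simpa [← sub_eq_add_neg] using! (multipliable_one_add_of_summable hs).hasProd.tendsto_prod_nat
  have hne : ∏' k : ℕ, (1 + -(p ^ (k + 1))) ≠ 0 := by
    refine tprod_one_add_ne_zero_of_summable (fun k => ?_) hs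
    have : p ^ (k + 1) < 1 := pow_lt_one₀ h0.le h1 (Nat.succ_ne_zero k)
    exact (by linarith : (0 : ℝ) < 1 + -(p ^ (k + 1))).ne'
  refine ⟨_, lt_of_le_of_ne ?_ hne.symm, ht, (eulerProd_antitone h0 h1).le_of_tendsto ht⟩
  exact ge_of_tendsto' ht fun n => (eulerProd_pos h0 h1 n).le

/-- `1 / (p; p)_n`, extended by `0` to negative integers. -/
noncomputable def invEuler (p : ℝ) (n : ℤ) : ℝ := if 0 ≤ n then (eulerProd p n.toNat)⁻¹ else 0

/-- The extension by `0` makes the recurrence hold on all of `ℤ`: at `n = 0` the factor `1 - p ^ 0`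
vanishes. -/
theorem invEuler_sub_one {p : ℝ} (h0 : 0 < p) (h1 : p < 1) (n : ℤ) :
    invEuler p (n - 1) = (1 - p ^ n) * invEuler p n := by
  unfold invEuler
  rcases lt_trichotomy n 0 with h | rfl | h
  · rw [if_neg (by omega), if_neg (by omega), mul_zero]
  · simp
  · obtain ⟨m, rfl⟩ : ∃ m : ℕ, n = m + 1 := ⟨(n - 1).toNat, by omega⟩
    rw [if_pos (by omega), if_pos (by omega)]
    have e1 : ((m : ℤ) + 1 - 1).toNat = m := by omega
    have e2 : ((m : ℤ) + 1).toNat = m + 1 := by omega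
    have e3 : p ^ ((m : ℤ) + 1) = p ^ (m + 1) := by exact_mod_cast zpow_natCast p (m + 1)
    rw [e1, e2, e3, eulerProd_succ]
    have := (eulerProd_pos h0 h1 m).ne'
    have : 1 - p ^ (m + 1) ≠ 0 := (sub_pos.2 (pow_lt_one₀ h0.le h1 (by omega))).ne'
    field_simp

theorem invEuler_nonneg {p : ℝ} (h0 : 0 < p) (h1 : p < 1) (n : ℤ) : 0 ≤ invEuler p n := by
  unfold invEuler
  split_ifs
  · exact (inv_pos.2 (eulerProd_pos h0 h1 _)).le
  · exact le_rfl

theorem invEuler_le {p L : ℝ} (hL : 0 < L) (h : ∀ n, L ≤ eulerProd p n) (n : ℤ) :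
    invEuler p n ≤ L⁻¹ := by
  unfold invEuler
  split_ifs
  · exact inv_anti₀ hL (h _)
  · positivity

theorem tendsto_invEuler {p L : ℝ} (hL : 0 < L) (h : Tendsto (eulerProd p) atTop (𝓝 L)) :
    Tendsto (invEuler p) atTop (𝓝 L⁻¹) := by
  have h2 : Tendsto (fun n : ℤ => (eulerProd p n.toNat)⁻¹) atTop (𝓝 L⁻¹) := by
    refine (h.comp ?_).inv₀ hL.ne'
    exact tendsto_atTop.2 fun b => (eventually_ge_atTop (b : ℤ)).mono fun n hn => by omega
  refine h2.congr' ((eventually_ge_atTop 0).mono fun n hn => ?_)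
  simp [invEuler, hn]

/-- The central Gaussian binomial coefficients `[2N, N + j]_p`. -/
noncomputable def centralGauss (p : ℝ) (N : ℕ) (j : ℤ) : ℝ :=
  eulerProd p (2 * N) * invEuler p (N + j) * invEuler p (N - j)

theorem centralGauss_zero (p : ℝ) (j : ℤ) : centralGauss p 0 j = if j = 0 then 1 else 0 := by
  unfold centralGauss invEuler
  by_cases h : j = 0
  · subst h; simp [eulerProd]
  · rw [if_neg h]
    rcases lt_or_gt_of_ne h with h' | h'
    · simp [not_le.2 h']
    · simp [not_le.2 h']

/-- The three terms match the expansion of the next factor pair, `(1 + z p^N)(1 + z⁻¹ p^(N+1)) = (1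
+ p^(2N+1)) + z p^N + z⁻¹ p^(N+1)`. All values of `invEuler` reduce to `a` and `b`, leaving a
polynomial identity in `u`, `v`, `p`. -/
theorem centralGauss_succ {p : ℝ} (h0 : 0 < p) (h1 : p < 1) (N : ℕ) (j : ℤ) :
    centralGauss p (N + 1) j = (1 + p ^ (2 * N + 1)) * centralGauss p N j
      + p ^ ((N : ℤ) - j + 1) * centralGauss p N (j - 1)
      + p ^ ((N : ℤ) + 1 + j) * centralGauss p N (j + 1) := by
  unfold centralGauss
  set a := invEuler p ((N : ℤ) + 1 + j) with ha
  set b := invEuler p ((N : ℤ) + 1 - j) with hb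
  set u := p ^ ((N : ℤ) + j) with hu
  set v := p ^ ((N : ℤ) - j) with hv
  have hu1 : p ^ ((N : ℤ) + 1 + j) = u * p := by
    rw [hu, ← zpow_add_one₀ h0.ne']; congr 1; ring
  have hv1 : p ^ ((N : ℤ) + 1 - j) = v * p := by
    rw [hv, ← zpow_add_one₀ h0.ne']; congr 1; ring
  have huv : p ^ (2 * N) = u * v := by
    rw [hu, hv, ← zpow_add₀ h0.ne', ← zpow_natCast]; congr 1; push_cast; ring
  have e1 : invEuler p ((N : ℤ) + j) = (1 - u * p) * a := by
    rw [ha, ← hu1, ← invEuler_sub_one h0 h1]; congr 1; ring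
  have e2 : invEuler p ((N : ℤ) - j) = (1 - v * p) * b := by
    rw [hb, ← hv1, ← invEuler_sub_one h0 h1]; congr 1; ring
  have e3 : invEuler p ((N : ℤ) + (j - 1)) = (1 - u) * ((1 - u * p) * a) := by
    rw [← e1, ← invEuler_sub_one h0 h1]; congr 1; ring
  have e4 : invEuler p ((N : ℤ) - (j + 1)) = (1 - v) * ((1 - v * p) * b) := by
    rw [← e2, ← invEuler_sub_one h0 h1]; congr 1; ring
  have e5 : invEuler p ((N : ℤ) - (j - 1)) = b := by rw [hb]; congr 1; ring
  have e6 : invEuler p ((N : ℤ) + (j + 1)) = a := by rw [ha]; congr 1; ring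
  have e7 : (N : ℤ) - j + 1 = N + 1 - j := by ring
  rw [Nat.cast_succ, ← ha, ← hb, show 2 * (N + 1) = 2 * N + 1 + 1 by ring, eulerProd_succ,
    eulerProd_succ, e1, e2, e3, e4, e5, e6, e7, hu1, hv1, pow_succ p (2 * N + 1),
    pow_succ p (2 * N), huv]
  ring

/-- The finite form of the Jacobi triple product identity. -/
theorem hasSum_finite_tripleProduct {q : ℝ} (hq : 1 < q) {z : ℂ} (hz : z ≠ 0) (N : ℕ) :
    HasSum (fun j : ℤ => (centralGauss q⁻¹ N j : ℂ) * ((thetaCoeff q j : ℂ) * z ^ j))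
      (∏ k ∈ Finset.range N, (1 + z * (q : ℂ)⁻¹ ^ k) * (1 + z⁻¹ * (q : ℂ)⁻¹ ^ (k + 1))) := by
  have hq0 : 0 < q := by linarith
  have hqc : (q : ℂ) ≠ 0 := by exact_mod_cast hq0.ne'
  have h0 : 0 < q⁻¹ := by positivity
  have h1 : q⁻¹ < 1 := inv_lt_one_of_one_lt₀ hq
  induction N with
  | zero =>
    simp only [centralGauss_zero, Finset.range_zero, Finset.prod_empty]
    convert! hasSum_ite_eq (0 : ℤ) (1 : ℂ) using 2 with j
    split_ifs with h <;> simp [h, thetaCoeff_zero]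
  | succ N ih =>
    rw [Finset.prod_range_succ]
    have hA := ih.mul_left (1 + (q : ℂ)⁻¹ ^ (2 * N + 1))
    have hB := ((Equiv.subRight (1 : ℤ)).hasSum_iff.2 ih).mul_left (z * (q : ℂ)⁻¹ ^ N)
    have hC := ((Equiv.addRight (1 : ℤ)).hasSum_iff.2 ih).mul_left (z⁻¹ * (q : ℂ)⁻¹ ^ (N + 1))
    convert! (hA.add hB).add hC using 1
    · funext j
      simp only [Function.comp, Equiv.subRight_apply, Equiv.coe_addRight]
      have t1 : thetaCoeff q j = thetaCoeff q (j - 1) * (q ^ (j - 1))⁻¹ := by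
        rw [← thetaCoeff_succ hq0, sub_add_cancel]
      rw [centralGauss_succ h0 h1, thetaCoeff_succ hq0]
      have t1' : (thetaCoeff q (j - 1) : ℂ) = thetaCoeff q j * (q : ℂ) ^ (j - 1) := by
        rw [t1]; push_cast; field_simp
      push_cast
      rw [t1', zpow_sub_one₀ hz, zpow_add_one₀ hz, show (N : ℤ) - j + 1 = N - (j - 1) by ring,
        zpow_sub₀ (inv_ne_zero hqc), show (N : ℤ) + 1 + j = (N + 1 : ℕ) + j by push_cast; ring,
        zpow_add₀ (inv_ne_zero hqc), zpow_natCast, zpow_natCast, inv_zpow, inv_zpow]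
      field_simp
    · rw [pow_succ, pow_succ, two_mul, pow_add]
      field_simp
      ring

theorem norm_centralGauss_le {p L : ℝ} (h0 : 0 < p) (h1 : p < 1) (hL : 0 < L)
    (h : ∀ n, L ≤ eulerProd p n) (N : ℕ) (j : ℤ) : |centralGauss p N j| ≤ L⁻¹ * L⁻¹ := by
  unfold centralGauss
  have a := invEuler_nonneg h0 h1 (N + j)
  have b := invEuler_nonneg h0 h1 (N - j)
  have c := (eulerProd_pos h0 h1 (2 * N)).le
  have d : eulerProd p (2 * N) ≤ 1 := by
    simpa [eulerProd] using eulerProd_antitone h0 h1 (Nat.zero_le (2 * N))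
  rw [abs_of_nonneg (by positivity)]
  refine mul_le_mul ?_ (invEuler_le hL h _) b (by positivity)
  calc _ ≤ 1 * L⁻¹ := mul_le_mul d (invEuler_le hL h _) a zero_le_one
    _ = _ := one_mul _

theorem tendsto_centralGauss {p L : ℝ} (hL : 0 < L)
    (h : Tendsto (eulerProd p) atTop (𝓝 L)) (j : ℤ) :
    Tendsto (fun N => centralGauss p N j) atTop (𝓝 L⁻¹) := by
  have h1 : Tendsto (fun N : ℕ => eulerProd p (2 * N)) atTop (𝓝 L) :=
    h.comp (tendsto_id.const_mul_atTop' (by norm_num))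
  have h2 : Tendsto (fun N : ℕ => invEuler p (N + j)) atTop (𝓝 L⁻¹) :=
    (tendsto_invEuler hL h).comp (tendsto_atTop_add_const_right _ _ tendsto_natCast_atTop_atTop)
  have h3 : Tendsto (fun N : ℕ => invEuler p (N - j)) atTop (𝓝 L⁻¹) :=
    (tendsto_invEuler hL h).comp (tendsto_atTop_add_const_right _ (-j) tendsto_natCast_atTop_atTop)
  convert! (h1.mul h2).mul h3 using 2
  field_simp

theorem multipliable_and_tprod_ne_zero {p : ℝ} (h0 : 0 < p) (h1 : p < 1) (c : ℂ)
    (hc : ∀ k : ℕ, 1 + c * (p : ℂ) ^ k ≠ 0) :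
    Multipliable (fun k : ℕ => 1 + c * (p : ℂ) ^ k) ∧ ∏' k : ℕ, (1 + c * (p : ℂ) ^ k) ≠ 0 := by
  have hs : Summable fun k : ℕ => ‖c * (p : ℂ) ^ k‖ := by
    simp only [norm_mul, norm_pow, Complex.norm_real, Real.norm_of_nonneg h0.le]
    exact (summable_geometric_of_lt_one h0.le h1).mul_left _
  exact ⟨multipliable_one_add_of_summable hs, tprod_one_add_ne_zero_of_summable hc hs⟩

/-- `Θ_q` has no zeros outside the negative real half-line. -/
theorem qTheta_ne_zero {q : ℝ} (hq : 1 < q) {z : ℂ} (hz : z ∈ Complex.slitPlane) :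
    qTheta q z ≠ 0 := by
  have hq0 : 0 < q := by linarith
  have hz0 : z ≠ 0 := Complex.slitPlane_ne_zero hz
  have h0 : 0 < q⁻¹ := by positivity
  have h1 : q⁻¹ < 1 := inv_lt_one_of_one_lt₀ hq
  -- A vanishing factor in either infinite product would make `z` a negative real.
  have key : ∀ x : ℝ, 0 < x → 1 + z * (x : ℂ) ≠ 0 := by
    intro x hx h
    have : z = ((-x⁻¹ : ℝ) : ℂ) := by
      have hxc : (x : ℂ) ≠ 0 := by exact_mod_cast hx.ne'
      push_cast
      field_simp
      linear_combination h
    rw [this, Complex.ofReal_mem_slitPlane] at hz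
    have : 0 < x⁻¹ := by positivity
    linarith
  obtain ⟨L, hL, ht, hle⟩ := exists_tendsto_eulerProd h0 h1
  have m1 := multipliable_and_tprod_ne_zero h0 h1 z fun k => by
    simpa using key (q⁻¹ ^ k) (by positivity)
  have m2 := multipliable_and_tprod_ne_zero h0 h1 (z⁻¹ * (q : ℂ)⁻¹) fun k h => by
    refine key (q ^ (k + 1)) (by positivity) ?_
    have hqc : (q : ℂ) ≠ 0 := by exact_mod_cast hq0.ne'
    push_cast at h ⊢
    have e : 1 + z * (q : ℂ) ^ (k + 1)
        = z * (q : ℂ) ^ (k + 1) * (1 + z⁻¹ * (q : ℂ)⁻¹ * ((q : ℂ)⁻¹) ^ k) := by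
      rw [inv_pow, pow_succ]; field_simp; ring
    rw [e, h, mul_zero]
  have lim1 := m1.1.hasProd.tendsto_prod_nat.mul m2.1.hasProd.tendsto_prod_nat
  -- Letting `N → ∞` in the finite identity yields `L⁻¹ Θ_q(z)` as a product of two nonzero infinite
  -- products.
  have lim2 : Tendsto (fun N : ℕ => ∑' j : ℤ,
      (centralGauss q⁻¹ N j : ℂ) * ((thetaCoeff q j : ℂ) * z ^ j)) atTop
      (𝓝 (∑' j : ℤ, ((L⁻¹ : ℝ) : ℂ) * ((thetaCoeff q j : ℂ) * z ^ j))) := by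
    refine tendsto_tsum_of_dominated_convergence
      (bound := fun j => L⁻¹ * L⁻¹ * ‖(thetaCoeff q j : ℂ) * z ^ j‖)
      ((summable_qTheta hq hz0).norm.mul_left _) (fun j => ?_)
      (Eventually.of_forall fun N j => ?_)
    · exact ((Complex.continuous_ofReal.tendsto _).comp (tendsto_centralGauss hL ht j)).mul_const _
    · rw [norm_mul, Complex.norm_real]
      exact mul_le_mul_of_nonneg_right (norm_centralGauss_le h0 h1 hL hle N j) (norm_nonneg _)
  have lim3 := lim1.congr' (f₂ := fun N : ℕ => ∑' j : ℤ,
      (centralGauss q⁻¹ N j : ℂ) * ((thetaCoeff q j : ℂ) * z ^ j)) <| Eventually.of_forall fun N => by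
    beta_reduce
    rw [(hasSum_finite_tripleProduct hq hz0 N).tsum_eq, ← Finset.prod_mul_distrib]
    refine Finset.prod_congr rfl fun k _ => ?_
    push_cast
    ring
  have heq := tendsto_nhds_unique lim2 lim3
  intro hΘ
  rw [tsum_mul_left, ← qTheta_eq, hΘ, mul_zero] at heq
  exact mul_ne_zero m1.2 m2.2 heq.symm

/-! ### Moments of `1 / Θ_q` along a half-line. -/

theorem mul_exp_mem_slitPlane {s : ℂ} (hs : s ∈ Complex.slitPlane) (x : ℝ) :
    s * (Real.exp x : ℂ) ∈ Complex.slitPlane := by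
  have hx := Real.exp_pos x
  rw [Complex.mem_slitPlane_iff] at hs ⊢
  rw [Complex.re_mul_ofReal, Complex.im_mul_ofReal]
  exact hs.imp (fun h => mul_pos h hx) fun h => mul_ne_zero h hx.ne'

/-- The function `w ↦ w ^ n / Θ_q(w)` along the half-line `w = s q ^ t`, `t ∈ ℝ`. -/
noncomputable def thetaKernel (q : ℝ) (s : ℂ) (n : ℕ) (t : ℝ) : ℂ :=
  (s * (Real.exp (Real.log q * t) : ℂ)) ^ n / qTheta q (s * (Real.exp (Real.log q * t) : ℂ))

theorem ofReal_exp_log_mul_add {q : ℝ} (hq : 0 < q) (t : ℝ) (k : ℤ) :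
    (Real.exp (Real.log q * (t + k)) : ℂ) = (q : ℂ) ^ k * (Real.exp (Real.log q * t) : ℂ) := by
  rw [mul_add, Real.exp_add, Real.exp_mul (Real.log q) k, Real.exp_log hq, Real.rpow_intCast]
  push_cast
  ring

theorem continuous_thetaKernel {q : ℝ} (hq : 1 < q) {s : ℂ} (hs : s ∈ Complex.slitPlane) (n : ℕ) :
    Continuous (thetaKernel q s n) := by
  have hw : Continuous fun t : ℝ => s * (Real.exp (Real.log q * t) : ℂ) := by fun_prop
  refine (hw.pow n).div ?_ fun t => qTheta_ne_zero hq (mul_exp_mem_slitPlane hs _)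
  exact continuous_iff_continuousAt.2 fun t => ContinuousAt.comp (g := qTheta q)
    (continuousAt_qTheta hq (Complex.slitPlane_ne_zero (mul_exp_mem_slitPlane hs _)))
    hw.continuousAt

theorem thetaKernel_zero_add_int {q : ℝ} (hq : 1 < q) {s : ℂ} (hs : s ∈ Complex.slitPlane)
    (t : ℝ) (k : ℤ) :
    thetaKernel q s 0 (t + k) = (thetaCoeff q (-k) : ℂ) *
      (s * (Real.exp (Real.log q * t) : ℂ)) ^ (-k) * thetaKernel q s 0 t := by
  have hq0 : 0 < q := by linarith
  have hqc : (q : ℂ) ≠ 0 := by exact_mod_cast hq0.ne'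
  have h1 := mul_exp_mem_slitPlane hs (Real.log q * t)
  have h2 := mul_exp_mem_slitPlane hs (Real.log q * (t + k))
  have e := qTheta_eq_zpow_mul hq (Complex.slitPlane_ne_zero h1) k
  unfold thetaKernel
  rw [ofReal_exp_log_mul_add hq0] at h2 ⊢
  rw [mul_left_comm] at h2 ⊢
  have n1 := qTheta_ne_zero hq h1
  have n2 := qTheta_ne_zero hq h2
  rw [pow_zero, pow_zero, mul_one_div, div_eq_div_iff n2 n1, e, one_mul]

theorem thetaKernel_succ {q : ℝ} (hq : 1 < q) {s : ℂ} (hs : s ∈ Complex.slitPlane)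
    (n : ℕ) (t : ℝ) :
    thetaKernel q s (n + 1) t = (q : ℂ) ^ n * thetaKernel q s n (t - 1) := by
  have hq0 : 0 < q := by linarith
  have hqc : (q : ℂ) ≠ 0 := by exact_mod_cast hq0.ne'
  have h1 := mul_exp_mem_slitPlane hs (Real.log q * (t - 1))
  have h0 := Complex.slitPlane_ne_zero h1
  have n1 := qTheta_ne_zero hq h1
  have e : s * (Real.exp (Real.log q * t) : ℂ) =
      q * (s * (Real.exp (Real.log q * (t - 1)) : ℂ)) := by
    have := ofReal_exp_log_mul_add hq0 (t - 1) 1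
    rw [Int.cast_one, sub_add_cancel, zpow_one] at this
    rw [this]; ring
  unfold thetaKernel
  rw [e]
  set w := s * (Real.exp (Real.log q * (t - 1)) : ℂ)
  rw [qTheta_q_mul hq h0, mul_pow, pow_succ, pow_succ]
  field_simp

/-- Compactness bounds the kernel on `[0, 1]`, and quasi-periodicity carries the bound to the other
unit intervals. There `|w|` runs over `[|s|, q|s|]`, so two Theta series majorize. -/
theorem exists_norm_thetaKernel_zero_le {q : ℝ} (hq : 1 < q) {s : ℂ}
    (hs : s ∈ Complex.slitPlane) :
    ∃ u : ℤ → ℝ, Summable u ∧ (∀ k, 0 ≤ u k) ∧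
      ∀ k : ℤ, ∀ t ∈ Set.Icc (0 : ℝ) 1, ‖thetaKernel q s 0 (t + k)‖ ≤ u k := by
  have hq0 : 0 < q := by linarith
  have hL : 0 < Real.log q := Real.log_pos hq
  have hs0 : 0 < ‖s‖ := norm_pos_iff.2 (Complex.slitPlane_ne_zero hs)
  obtain ⟨M, hM⟩ := isCompact_Icc.exists_bound_of_continuousOn
    (continuous_thetaKernel hq hs 0).continuousOn (s := Set.Icc (0 : ℝ) 1)
  have hM0 : 0 ≤ M := (norm_nonneg _).trans (hM 0 (by simp))
  refine ⟨fun k => thetaCoeff q (-k) * (‖s‖ ^ (-k) + (‖s‖ * q) ^ (-k)) * M, ?_, fun k => ?_,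
    fun k t ht => ?_⟩
  · exact ((Equiv.neg ℤ).summable_iff.2
      (summable_thetaCoeff_add hq hs0 (mul_pos hs0 hq0))).mul_right M
  · have := thetaCoeff_pos hq0 (-k)
    positivity
  · rw [thetaKernel_zero_add_int hq hs, norm_mul, norm_thetaCoeff_mul hq0]
    have hw : ‖s * (Real.exp (Real.log q * t) : ℂ)‖ = ‖s‖ * Real.exp (Real.log q * t) := by
      rw [norm_mul, Complex.norm_real, Real.norm_of_nonneg (Real.exp_pos _).le]
    rw [hw]
    refine mul_le_mul (mul_le_mul_of_nonneg_left (zpow_le_zpow_add_zpow hs0 ?_ ?_ _)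
      (thetaCoeff_pos hq0 _).le) (hM t ht) (norm_nonneg _) ?_
    · exact le_mul_of_one_le_right hs0.le (Real.one_le_exp (mul_nonneg hL.le ht.1))
    · refine mul_le_mul_of_nonneg_left ?_ hs0.le
      calc Real.exp (Real.log q * t) ≤ Real.exp (Real.log q) :=
            Real.exp_le_exp.2 (mul_le_of_le_one_right hL.le ht.2)
        _ = q := Real.exp_log hq0
    · have := thetaCoeff_pos hq0 (-k)
      positivity

theorem integrable_thetaKernel_zero {q : ℝ} (hq : 1 < q) {s : ℂ} (hs : s ∈ Complex.slitPlane) :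
    Integrable (thetaKernel q s 0) := by
  obtain ⟨u, hu, hu0, hle⟩ := exists_norm_thetaKernel_zero_le hq hs
  let f : C(ℝ, ℂ) := ⟨thetaKernel q s 0, continuous_thetaKernel hq hs 0⟩
  refine Real.integrable_of_summable_norm_Icc (f := f)
    (hu.of_nonneg_of_le (fun k => norm_nonneg _) fun k => ?_)
  exact (ContinuousMap.norm_le _ (hu0 k)).2 fun t => hle k t t.2

theorem integral_thetaKernel_zero {q : ℝ} (hq : 1 < q) {s : ℂ} (hs : s ∈ Complex.slitPlane) :
    ∫ t, thetaKernel q s 0 t = 1 := by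
  obtain ⟨u, hu, hu0, hle⟩ := exists_norm_thetaKernel_zero_le hq hs
  let f : ℤ → C(ℝ, ℂ) := fun k =>
    ⟨fun t => thetaKernel q s 0 (t + k),
      (continuous_thetaKernel hq hs 0).comp (continuous_id.add continuous_const)⟩
  have h1 := (integrable_thetaKernel_zero hq hs).hasSum_intervalIntegral_comp_add_int
  have h2 := intervalIntegral.hasSum_intervalIntegral_of_summable_norm (a := 0) (b := 1) (f := f)
    (hu.of_nonneg_of_le (fun k => norm_nonneg _) fun k =>
      (ContinuousMap.norm_le _ (hu0 k)).2 fun t => hle k t (by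
        have := t.2
        rwa [← Set.uIcc_of_le (zero_le_one' ℝ)]))
  rw [h1.unique h2]
  have h3 : ∀ t : ℝ, ∑' k : ℤ, f k t = 1 := by
    intro t
    have hw := mul_exp_mem_slitPlane hs (Real.log q * t)
    have e : ∀ k : ℤ, f k t = (thetaCoeff q (-k) : ℂ) *
      (s * (Real.exp (Real.log q * t) : ℂ)) ^ (-k) * thetaKernel q s 0 t :=
      thetaKernel_zero_add_int hq hs t
    simp only [e]
    have hneg := (Equiv.neg ℤ).tsum_eq fun k : ℤ => (thetaCoeff q k : ℂ) *
      (s * (Real.exp (Real.log q * t) : ℂ)) ^ k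
    simp only [Equiv.neg_apply] at hneg
    rw [tsum_mul_right, hneg, ← qTheta_eq, thetaKernel, pow_zero,
      mul_one_div, div_self (qTheta_ne_zero hq hw)]
  simp [h3]

theorem integrable_thetaKernel {q : ℝ} (hq : 1 < q) {s : ℂ} (hs : s ∈ Complex.slitPlane)
    (n : ℕ) : Integrable (thetaKernel q s n) := by
  induction n with
  | zero => exact integrable_thetaKernel_zero hq hs
  | succ n ih =>
    rw [funext (thetaKernel_succ hq hs n)]
    exact (ih.comp_sub_right 1).const_mul _

theorem integral_thetaKernel {q : ℝ} (hq : 1 < q) {s : ℂ} (hs : s ∈ Complex.slitPlane)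
    (n : ℕ) : thetaCoeff q n * ∫ t, thetaKernel q s n t = 1 := by
  have hq0 : 0 < q := by linarith
  have hqc : (q : ℂ) ≠ 0 := by exact_mod_cast hq0.ne'
  induction n with
  | zero => simp [integral_thetaKernel_zero hq hs, thetaCoeff_zero]
  | succ n ih =>
    rw [funext (thetaKernel_succ hq hs n), integral_const_mul,
      integral_sub_right_eq_self (thetaKernel q s n), Nat.cast_succ, thetaCoeff_succ hq0,
      zpow_natCast, ← ih]
    push_cast
    field_simp

/-- The normalized kernels have the same `L¹` norm for all `n`, so only `|λ|⁻¹ ^ n` governs the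
summability of the termwise integrals. -/
theorem integral_norm_thetaKernel {q : ℝ} (hq : 1 < q) {s : ℂ} (hs : s ∈ Complex.slitPlane)
    (n : ℕ) : thetaCoeff q n * ∫ t, ‖thetaKernel q s n t‖ = ∫ t, ‖thetaKernel q s 0 t‖ := by
  have hq0 : 0 < q := by linarith
  induction n with
  | zero => simp [thetaCoeff_zero]
  | succ n ih =>
    have e : ∀ t, ‖thetaKernel q s (n + 1) t‖ = q ^ n * ‖thetaKernel q s n (t - 1)‖ := fun t => by
      rw [thetaKernel_succ hq hs, norm_mul, norm_pow, Complex.norm_real,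
        Real.norm_of_nonneg hq0.le]
    rw [funext e, integral_const_mul,
      integral_sub_right_eq_self (fun t => ‖thetaKernel q s n t‖), Nat.cast_succ,
      thetaCoeff_succ hq0, zpow_natCast, ← ih]
    field_simp

/-! ### The substitution `r = q ^ t` and the integral against `E_q`. -/

theorem range_exp_mul_eq_Ioi {L : ℝ} (hL : 0 < L) :
    (fun t : ℝ => Real.exp (L * t)) '' Set.univ = Set.Ioi 0 := by
  rw [Set.image_univ]
  have : (fun t : ℝ => Real.exp (L * t)) = Real.exp ∘ fun t => L * t := rfl
  rw [this, Function.Surjective.range_comp (fun y => ⟨y / L, by field_simp⟩), Real.range_exp]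

theorem hasDerivWithinAt_exp_mul (L x : ℝ) (S : Set ℝ) :
    HasDerivWithinAt (fun t : ℝ => Real.exp (L * t)) (Real.exp (L * x) * L) S x := by
  have h : HasDerivAt (fun t : ℝ => L * t) L x := by simpa using (hasDerivAt_id x).const_mul L
  exact h.exp.hasDerivWithinAt

theorem injOn_exp_mul {L : ℝ} (hL : 0 < L) :
    Set.InjOn (fun t : ℝ => Real.exp (L * t)) Set.univ := fun _ _ _ _ h =>
  mul_left_cancel₀ hL.ne' (Real.exp_injective h)

theorem integrableOn_Ioi_iff_exp_mul {L : ℝ} (hL : 0 < L) (g : ℝ → ℂ) :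
    IntegrableOn g (Set.Ioi 0) ↔
      Integrable fun t : ℝ => ((Real.exp (L * t) * L : ℝ) : ℂ) * g (Real.exp (L * t)) := by
  rw [← range_exp_mul_eq_Ioi hL, integrableOn_image_iff_integrableOn_abs_deriv_smul
    MeasurableSet.univ (fun x _ => hasDerivWithinAt_exp_mul L x _) (injOn_exp_mul hL),
    integrableOn_univ]
  refine iff_of_eq (congrArg (Integrable · volume) (funext fun t => ?_))
  rw [abs_of_pos (mul_pos (Real.exp_pos _) hL), Complex.real_smul]

theorem integral_Ioi_eq_exp_mul {L : ℝ} (hL : 0 < L) (g : ℝ → ℂ) :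
    ∫ r in Set.Ioi 0, g r =
      ∫ t : ℝ, ((Real.exp (L * t) * L : ℝ) : ℂ) * g (Real.exp (L * t)) := by
  rw [← range_exp_mul_eq_Ioi hL, integral_image_eq_integral_abs_deriv_smul
    MeasurableSet.univ (fun x _ => hasDerivWithinAt_exp_mul L x _) (injOn_exp_mul hL),
    setIntegral_univ]
  refine integral_congr_ae (Eventually.of_forall fun t => ?_)
  beta_reduce
  rw [abs_of_pos (mul_pos (Real.exp_pos _) hL), Complex.real_smul]

/-- The integral of `E_q(w / (qλ)) / Θ_q(w)` along the half-line through `s`, in the parametrization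
`w = s q ^ t`. -/
theorem integral_qE_div_qTheta {q : ℝ} (hq : 1 < q) {s lam : ℂ} (hs : s ∈ Complex.slitPlane)
    (hlam : 1 < ‖lam‖) :
    ∫ t : ℝ, qE q (s * (Real.exp (Real.log q * t) : ℂ) / (q * lam)) *
      thetaKernel q s 1 t = lam / (lam - 1) := by
  have hq0 : 0 < q := by linarith
  have hqc : (q : ℂ) ≠ 0 := by exact_mod_cast hq0.ne'
  have hl0 : lam ≠ 0 := norm_pos_iff.1 (by linarith)
  have hinv : ‖lam⁻¹‖ < 1 := by rw [norm_inv]; exact inv_lt_one_of_one_lt₀ hlam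
  -- The extra factor `w` and the `q ^ (-n)` from `w / (qλ)` raise the index, since `c_n q ^ (-n) =
  -- c_(n+1)`.
  set F : ℕ → ℝ → ℂ := fun n t =>
    lam⁻¹ ^ n * ((thetaCoeff q (n + 1 : ℕ) : ℂ) * thetaKernel q s (n + 1) t) with hF
  have hFE : ∀ t, qE q (s * (Real.exp (Real.log q * t) : ℂ) / (q * lam)) * thetaKernel q s 1 t
      = ∑' n, F n t := by
    intro t
    rw [qE_eq, ← tsum_mul_right]
    refine tsum_congr fun n => ?_
    rw [hF]
    beta_reduce
    rw [Nat.cast_succ, thetaCoeff_succ hq0, thetaKernel, thetaKernel, zpow_natCast]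
    push_cast
    rw [div_pow, mul_pow (q : ℂ), pow_succ _ n, pow_one, inv_pow]
    field_simp
  have hFint : ∀ n, Integrable (F n) := fun n =>
    ((integrable_thetaKernel hq hs (n + 1)).const_mul _).const_mul _
  have hFnorm : ∀ n, ∫ t, ‖F n t‖ = ‖lam⁻¹‖ ^ n * ∫ t, ‖thetaKernel q s 0 t‖ := by
    intro n
    have hc : ∀ t, ‖F n t‖ = ‖lam⁻¹‖ ^ n *
        (thetaCoeff q (n + 1 : ℕ) * ‖thetaKernel q s (n + 1) t‖) := fun t => by
      rw [hF]
      beta_reduce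
      rw [norm_mul, norm_mul, norm_pow, Complex.norm_real,
        Real.norm_of_nonneg (thetaCoeff_pos hq0 _).le]
    rw [funext hc, integral_const_mul, integral_const_mul, integral_norm_thetaKernel hq hs]
  have hsum : Summable fun n => ∫ t, ‖F n t‖ := by
    rw [funext hFnorm]
    exact (summable_geometric_of_lt_one (norm_nonneg _) hinv).mul_right _
  have h := hasSum_integral_of_summable_integral_norm hFint hsum
  have hval : ∀ n, ∫ t, F n t = lam⁻¹ ^ n := fun n => by
    rw [hF]
    beta_reduce
    rw [integral_const_mul, integral_const_mul, integral_thetaKernel hq hs, mul_one]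
  rw [funext hval] at h
  rw [funext hFE, h.unique (hasSum_geometric_of_norm_lt_one hinv)]
  have hne : lam - 1 ≠ 0 := fun h0 => by
    rw [sub_eq_zero.1 h0, norm_one] at hlam; exact lt_irrefl _ hlam
  rw [inv_eq_iff_eq_inv, inv_div]
  field_simp

/-! ### Growth exponents of `E_q`. -/

theorem thetaCoeff_natCast {q : ℝ} (hq : 0 < q) (n : ℕ) :
    thetaCoeff q n = Real.exp (-(Real.log q * (n * (n - 1) / 2))) := by
  induction n with
  | zero => simp [thetaCoeff_zero]
  | succ n ih =>
    have h : (q ^ n)⁻¹ = Real.exp (-(Real.log q * n)) := by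
      rw [Real.exp_neg, Real.exp_mul, Real.exp_log hq, Real.rpow_natCast]
    rw [Nat.cast_succ, thetaCoeff_succ hq, ih, zpow_natCast, h, ← Real.exp_add]
    congr 1
    push_cast
    ring

theorem isGrowthExponent_one {q : ℝ} (hq : 1 < q) : IsGrowthExponent q 1 := by
  have hq0 : 0 < q := by linarith
  have hL : 0 < Real.log q := Real.log_pos hq
  set L := Real.log q with hLdef
  have hr : Real.exp (-(L / 2)) < 1 := by
    rw [← Real.exp_zero]; exact Real.exp_lt_exp.2 (by linarith)
  have hgeo := hasSum_geometric_of_lt_one (Real.exp_pos (-(L / 2))).le hr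
  refine ⟨Real.exp (L / 2) * (1 - Real.exp (-(L / 2)))⁻¹,
    mul_pos (Real.exp_pos _) (inv_pos.2 (by linarith)), fun z hz => ?_⟩
  have hn : 0 < ‖z‖ := norm_pos_iff.2 hz
  set y := Real.log ‖z‖ with hy
  have hzy : ‖z‖ = Real.exp y := (Real.exp_log hn).symm
  have hterm : ∀ n : ℕ, ‖(thetaCoeff q n : ℂ) * z ^ n‖ ≤
      Real.exp (y ^ 2 / (2 * L) + y + L / 2) * Real.exp (-(L / 2)) ^ n := by
    intro n
    rw [norm_mul, norm_pow, Complex.norm_real, Real.norm_of_nonneg (thetaCoeff_pos hq0 _).le,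
      thetaCoeff_natCast hq0, hzy, ← Real.exp_nat_mul, ← Real.exp_nat_mul, ← Real.exp_add,
      ← Real.exp_add, Real.exp_le_exp]
    -- Completing the square; `α = 1` leaves room for the geometric factor `q ^ (-n/2)`.
    have h : y ^ 2 / (2 * L) + y + L / 2 + n * -(L / 2) - (-(L * (n * (n - 1) / 2)) + n * y)
        = L / 2 * (n - y / L - 1) ^ 2 := by field_simp; ring
    have : 0 ≤ L / 2 * (n - y / L - 1) ^ 2 := by positivity
    linarith
  rw [qE_eq]
  refine (tsum_of_norm_bounded (hgeo.mul_left _) hterm).trans (le_of_eq ?_)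
  rw [Real.exp_add, Real.exp_add, Real.rpow_one, hzy]
  ring

/-- At `z = q ^ m` all terms are positive and the `m`-th alone equals `q ^ (m²/2 + m/2)`, against
the bound `K q ^ (m²/2 + mα)`. -/
theorem IsGrowthExponent.half_le {q α : ℝ} (hq : 1 < q) (h : IsGrowthExponent q α) :
    1 / 2 ≤ α := by
  have hq0 : 0 < q := by linarith
  have hL : 0 < Real.log q := Real.log_pos hq
  obtain ⟨K, -, hK⟩ := h
  by_contra! hα
  set L := Real.log q with hLdef
  have hc : 0 < L * (1 / 2 - α) := mul_pos hL (by linarith)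
  have main : ∀ m : ℕ, Real.exp (m * (L * (1 / 2 - α))) ≤ K := by
    intro m
    have hpos : 0 < Real.exp (L * m) := Real.exp_pos _
    have hne : (Real.exp (L * m) : ℂ) ≠ 0 := by exact_mod_cast hpos.ne'
    have hb := hK (Real.exp (L * m) : ℂ) hne
    have hnorm : ‖(Real.exp (L * m) : ℂ)‖ = Real.exp (L * m) := by
      rw [Complex.norm_real, Real.norm_of_nonneg hpos.le]
    rw [hnorm, Real.log_exp, ← Real.exp_mul, mul_assoc, ← Real.exp_add] at hb
    have hE : qE q (Real.exp (L * m) : ℂ)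
        = ((∑' n : ℕ, thetaCoeff q n * Real.exp (L * m) ^ n : ℝ) : ℂ) := by
      rw [qE_eq]; push_cast; rfl
    have hle : thetaCoeff q m * Real.exp (L * m) ^ m ≤ ‖qE q (Real.exp (L * m) : ℂ)‖ := by
      rw [hE, Complex.norm_real]
      refine le_trans ?_ (Real.le_norm_self _)
      exact (summable_thetaCoeff_nat hq hpos).le_tsum m fun n _ =>
        (mul_pos (thetaCoeff_pos hq0 n) (pow_pos hpos n)).le
    rw [thetaCoeff_natCast hq0, ← Real.exp_nat_mul, ← Real.exp_add] at hle
    have h2 := hle.trans hb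
    have h3 : Real.exp (m * (L * (1 / 2 - α))) *
        Real.exp ((L * m) ^ 2 / (2 * L) + L * m * α)
        = Real.exp (-(L * (m * (m - 1) / 2)) + m * (L * m)) := by
      rw [← Real.exp_add]
      congr 1
      field_simp
      ring
    exact le_of_mul_le_mul_right (h3.le.trans h2) (Real.exp_pos _)
  obtain ⟨m, hm⟩ := exists_nat_gt (K / (L * (1 / 2 - α)))
  rw [div_lt_iff₀ hc] at hm
  have := Real.add_one_le_exp (m * (L * (1 / 2 - α)))
  linarith [main m]

/-! ### The integral along the ray. -/

theorem mul_mul_exp_mem_slitPlane {q : ℝ} (hq : 0 < q) {lam : ℂ} (hlam : lam ≠ 0) {d : ℝ}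
    (hd : ∀ k : ℤ, Complex.arg lam + d ≠ (2 * k + 1) * Real.pi) :
    q * lam * Complex.exp (d * Complex.I) ∈ Complex.slitPlane := by
  have hR : 0 < q * ‖lam‖ := mul_pos hq (norm_pos_iff.2 hlam)
  have e : q * lam * Complex.exp (d * Complex.I)
      = ((q * ‖lam‖ : ℝ) : ℂ) * Complex.exp ((Complex.arg lam + d : ℝ) * Complex.I) := by
    conv_lhs => rw [← Complex.norm_mul_exp_arg_mul_I lam]
    push_cast
    rw [add_mul, Complex.exp_add]
    ring
  rw [e, Complex.mem_slitPlane_iff, Complex.re_ofReal_mul, Complex.im_ofReal_mul,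
    Complex.exp_ofReal_mul_I_re, Complex.exp_ofReal_mul_I_im]
  by_cases hsin : Real.sin (Complex.arg lam + d) = 0
  · left
    obtain ⟨k, hk⟩ := Real.sin_eq_zero_iff.1 hsin
    obtain ⟨m, rfl | rfl⟩ := k.even_or_odd'
    · have : Complex.arg lam + d = m * (2 * Real.pi) := by rw [← hk]; push_cast; ring
      rw [this, Real.cos_int_mul_two_pi, mul_one]
      exact hR
    · exact absurd (by rw [← hk]; push_cast; ring) (hd m)
  · exact Or.inr (mul_ne_zero hR.ne' hsin)

theorem proposition2 (q : ℝ) (hq : 1 < q) :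
    (∃ α : ℝ, IsGrowthExponent q α) ∧
    ∀ α : ℝ, IsGrowthExponent q α →
      ∀ ω z : ℂ, ω ≠ 0 → z ≠ 0 → ω ≠ z →
      ∀ d : ℝ, (∀ k : ℤ, Complex.arg (ω / z) + d ≠ (2 * k + 1) * Real.pi) →
        q ^ (α - 1 / 2) < ‖ω / z‖ →
        RayIntegrable d (fun ξ => qE q ξ / qTheta q (q * (ω * ξ / z))) ∧
        z / (ω - z) = (q : ℂ) / (Real.log q : ℂ) *
          rayIntegral d (fun ξ => qE q ξ / qTheta q (q * (ω * ξ / z))) := by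
  refine ⟨⟨1, isGrowthExponent_one hq⟩, fun α hα ω z hω hz hωz d hd hlt => ?_⟩
  have hq0 : 0 < q := by linarith
  have hqc : (q : ℂ) ≠ 0 := by exact_mod_cast hq0.ne'
  have hL : 0 < Real.log q := Real.log_pos hq
  have hLc : (Real.log q : ℂ) ≠ 0 := by exact_mod_cast hL.ne'
  have hlam : 1 < ‖ω / z‖ :=
    (Real.one_le_rpow hq.le (sub_nonneg.2 (hα.half_le hq))).trans_lt hlt
  have hlam0 : ω / z ≠ 0 := div_ne_zero hω hz
  have hs := mul_mul_exp_mem_slitPlane hq0 hlam0 hd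
  set s := q * (ω / z) * Complex.exp (d * Complex.I) with hsdef
  have hsub : ω - z ≠ 0 := sub_ne_zero.2 hωz
  have hint := integral_qE_div_qTheta hq hs hlam
  have hpt : ∀ t : ℝ, ((Real.exp (Real.log q * t) * Real.log q : ℝ) : ℂ) *
      (qE q ((Real.exp (Real.log q * t) : ℝ) * Complex.exp (d * Complex.I)) /
        qTheta q (q * (ω * ((Real.exp (Real.log q * t) : ℝ) * Complex.exp (d * Complex.I)) / z)) *
        Complex.exp (d * Complex.I))
      = Real.log q / (q * (ω / z)) *
        (qE q (s * (Real.exp (Real.log q * t) : ℂ) / (q * (ω / z))) * thetaKernel q s 1 t) := by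
    intro t
    set r := Real.exp (Real.log q * t) with hr
    have e1 : s * (r : ℂ) / (q * (ω / z)) = r * Complex.exp (d * Complex.I) := by
      rw [hsdef]; field_simp
    have e2 : q * (ω * (r * Complex.exp (d * Complex.I)) / z) = s * r := by
      rw [hsdef]; ring
    rw [e1, e2, thetaKernel, ← hr, pow_one]
    have e4 : s * (r : ℂ) = q * (ω / z) * (r * Complex.exp (d * Complex.I)) := by
      rw [hsdef]; ring
    rw [div_mul_eq_mul_div, mul_div_assoc', mul_div_assoc', mul_div_assoc']
    rw [e4]
    push_cast
    field_simp
  refine ⟨?_, ?_⟩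
  · refine (integrableOn_Ioi_iff_exp_mul hL _).2 ?_
    simp only [hpt]
    refine Integrable.const_mul ?_ _
    -- A non-integrable function has integral `0` by convention, so the nonzero value `λ / (λ - 1)`
    -- already proves integrability.
    refine not_imp_comm.1 integral_undef ?_
    rw [hint]
    refine div_ne_zero hlam0 fun h => ?_
    rw [sub_eq_zero.1 h, norm_one] at hlam
    exact lt_irrefl _ hlam
  · rw [rayIntegral, integral_Ioi_eq_exp_mul hL]
    simp only [hpt]
    rw [integral_const_mul, hint]
    have e : ω / z - 1 = (ω - z) / z := by field_simp
    rw [e]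
    field_simp
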